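/- Let $a,b,c$ be real numbers and let $\sigma^2>0$. Put $$D=(1-a-b-c)(1-a+b+c)(1+a-b+c)(1+a+b-c).$$ Then the following are equivalent. (i) On some probability space there exist a collection $\epsilon=\{\epsilon_{i,j}: i,j\in\mathbb{Z}\}$ of pairwise uncorrelated real random variables with $\mathbb{E}\,\epsilon_{i,j}=0$ and $\operatorname{Var}(\epsilon_{i,j})=\sigma^2$ for all $i,j\in\mathbb{Z}$, and a wide-sense stationary real random field $X=\{X_{i,j}: i,j\in\mathbb{Z}\}$, such that almost surely $$X_{i,j}=a\,X_{i-1,j}+b\,X_{i,j-1}+c\,X_{i-1,j-1}+\epsilon_{i,j}\qquad\text{for all } i,j\in\mathbb{Z}.$$ (ii) $D>0$. Here $X$ is called wide-sense stationary if every $X_{i,j}$ has a finite second moment, $\mathbb{E}X_{i,j}$ does not depend on $(i,j)$, and $\operatorname{Cov}(X_{i,j},X_{i-h_1,j-h_2})$ depends only on $(h_1,h_2)$. -/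

import Mathlib

open MeasureTheory ProbabilityTheory

universe u

/-- A collection `ε` of uncorrelated real random variables indexed by `ℤ²`, with zero mean and
equal (finite) variance `v`. -/
structure IsWhiteNoise {Ω : Type u} [MeasurableSpace Ω] (P : Measure Ω)
    (ε : ℤ → ℤ → Ω → ℝ) (v : ℝ) : Prop where
  measurable : ∀ i j, Measurable (ε i j)
  memLp_two : ∀ i j, MemLp (ε i j) 2 P
  mean_eq_zero : ∀ i j, ∫ ω, ε i j ω ∂P = 0
  variance_eq : ∀ i j, variance (ε i j) P = v
  uncorrelated : ∀ i j k l, (i, j) ≠ (k, l) → covariance (ε i j) (ε k l) P = 0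

/-- A wide-sense stationary real random field on `ℤ²`: square-integrable, with constant mean, and
with covariances that depend only on the difference of the two sites. -/
structure IsWideSenseStationary {Ω : Type u} [MeasurableSpace Ω] (P : Measure Ω)
    (X : ℤ → ℤ → Ω → ℝ) : Prop where
  measurable : ∀ i j, Measurable (X i j)
  memLp_two : ∀ i j, MemLp (X i j) 2 P
  mean_const : ∃ m : ℝ, ∀ i j, ∫ ω, X i j ω ∂P = m
  covariance_shift : ∃ γ : ℤ → ℤ → ℝ, ∀ i j h₁ h₂,
    covariance (X i j) (X (i - h₁) (j - h₂)) P = γ h₁ h₂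

/-- The planar autoregressive equation
`X i j = a X (i-1) j + b X i (j-1) + c X (i-1) (j-1) + ε i j`, as an almost sure identity of random
variables at every site. -/
def SatisfiesPlanarAR {Ω : Type u} [MeasurableSpace Ω] (P : Measure Ω) (a b c : ℝ)
    (X ε : ℤ → ℤ → Ω → ℝ) : Prop :=
  ∀ i j, ∀ᵐ ω ∂P, X i j ω =
    a * X (i - 1) j ω + b * X i (j - 1) ω + c * X (i - 1) (j - 1) ω + ε i j ω

/-! Put K = 1 + a² - b² - c² and L = 2(a + bc), so that D = K² - L². For |z| = 1, |1 - az|² - |b +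
cz|² = K - L Re z, hence the symbol 1 - az - bw - czw has a zero on the torus exactly when |K| ≤
|L|, that is, when D ≤ 0. Necessity: r(k) = Cov(X_k, ε_0) is a Green function, and Bessel's
inequality (`sum_sq_covariance_le`) makes it square-summable. If D ≤ 0, a torus zero yields a
bounded solution of the homogeneous adjoint equation. Cut off logarithmically, it keeps the value 1
at the origin while the squared ℓ² norm of its error is O(1/log N) (`exists_small_energy`). Pairing
with r and using Cauchy–Schwarz forces σ² = 0. Sufficiency: the same identity with isometries in
place of z and w bounds the adjoint operator below (`exists_pos_mul_norm_le_planarAR`). Lax–Milgram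
then gives an ℓ² kernel, and X is the noise filtered by it. -/

/-! ### Torus zeros of the symbol. -/

lemma planarAR_discriminant (a b c : ℝ) :
    (1 - a - b - c) * (1 - a + b + c) * (1 + a - b + c) * (1 + a + b - c) =
      (1 + a ^ 2 - b ^ 2 - c ^ 2) ^ 2 - (2 * (a + b * c)) ^ 2 := by
  ring

/-- If the discriminant is nonpositive then the symbol has a zero on the torus. -/
lemma exists_torus_zero (a b c : ℝ)
    (hD : (1 - a - b - c) * (1 - a + b + c) * (1 + a - b + c) * (1 + a + b - c) ≤ 0) :
    ∃ z w : ℂ, ‖z‖ = 1 ∧ ‖w‖ = 1 ∧ 1 = a * z + b * w + c * (z * w) := by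
  rw [planarAR_discriminant, sub_nonpos, sq_le_sq] at hD
  obtain ⟨x, hx1, hx⟩ : ∃ x : ℝ, |x| ≤ 1 ∧
      1 + a ^ 2 - b ^ 2 - c ^ 2 = 2 * (a + b * c) * x := by
    rcases eq_or_ne (2 * (a + b * c)) 0 with h0 | h0
    · refine ⟨0, by simp, ?_⟩
      rw [h0, abs_zero, abs_nonpos_iff] at hD
      rw [hD, mul_zero]
    · refine ⟨(1 + a ^ 2 - b ^ 2 - c ^ 2) / (2 * (a + b * c)), ?_, (mul_div_cancel₀ _ h0).symm⟩
      rw [abs_div]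
      exact div_le_one_of_le₀ hD (abs_nonneg _)
  have hx2 : 0 ≤ 1 - x ^ 2 := by
    have := (sq_le_one_iff_abs_le_one x).2 hx1
    linarith
  set y := Real.sqrt (1 - x ^ 2) with hy
  have hxy : x ^ 2 + y ^ 2 = 1 := by rw [hy, Real.sq_sqrt hx2]; ring
  have nsq (s : ℂ) : ‖s‖ ^ 2 = s.re ^ 2 + s.im ^ 2 := by
    rw [Complex.sq_norm, Complex.normSq_apply]; ring
  set z : ℂ := ⟨x, y⟩ with hz
  have hz1 : ‖z‖ = 1 := by
    rw [← sq_eq_sq₀ (norm_nonneg _) zero_le_one, nsq]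
    simpa using hxy
  have hAB : ‖1 - a * z‖ = ‖b + c * z‖ := by
    rw [← sq_eq_sq₀ (norm_nonneg _) (norm_nonneg _), nsq, nsq]
    simp [hz]
    linear_combination hx + (a ^ 2 - c ^ 2) * hxy
  -- The equation reads 1 - az = w(b + cz) with sides of equal modulus; if both vanish, any
  -- unimodular w works.
  rcases eq_or_ne (b + c * z) 0 with h0 | h0
  · refine ⟨z, 1, hz1, by simp, ?_⟩
    rw [h0, norm_zero, norm_eq_zero] at hAB
    linear_combination hAB - h0
  · refine ⟨z, (1 - a * z) / (b + c * z), hz1, ?_, ?_⟩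
    · rw [norm_div, hAB, div_self (norm_ne_zero_iff.2 h0)]
    · linear_combination -mul_div_cancel₀ (1 - a * z) h0

/-- A bounded real solution of the homogeneous adjoint equation. -/
lemma exists_bounded_homogeneous_solution (a b c : ℝ)
    (hD : (1 - a - b - c) * (1 - a + b + c) * (1 + a - b + c) * (1 + a + b - c) ≤ 0) :
    ∃ u : ℤ × ℤ → ℝ, u 0 = 1 ∧ (∀ k, |u k| ≤ 1) ∧
      ∀ k, u k = a * u (k + (1, 0)) + b * u (k + (0, 1)) + c * u (k + (1, 1)) := by
  obtain ⟨z, w, hz, hw, h⟩ := exists_torus_zero a b c hD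
  have hz0 : z ≠ 0 := by rintro rfl; simp at hz
  have hw0 : w ≠ 0 := by rintro rfl; simp at hw
  refine ⟨fun k => (z ^ k.1 * w ^ k.2).re, by simp, fun k => ?_, fun k => ?_⟩
  · refine (Complex.abs_re_le_norm _).trans ?_
    simp [hz, hw]
  · have : z ^ k.1 * w ^ k.2 = a * (z ^ (k.1 + 1) * w ^ k.2) + b * (z ^ k.1 * w ^ (k.2 + 1)) +
        c * (z ^ (k.1 + 1) * w ^ (k.2 + 1)) := by
      rw [zpow_add_one₀ hz0, zpow_add_one₀ hw0]
      linear_combination (z ^ k.1 * w ^ k.2) * h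
    have h2 := congrArg Complex.re this
    simp only [Complex.add_re, Complex.re_ofReal_mul] at h2
    simpa using h2

/-! ### Logarithmic cut-off on boxes. -/

/-- The sup-norm on `ℤ²`, as a natural number. -/
def boxNorm (k : ℤ × ℤ) : ℕ := max k.1.natAbs k.2.natAbs

/-- The logarithmic cut-off `max 0 (1 - H n / H N)`. -/
noncomputable def logCutoff (N n : ℕ) : ℝ := max 0 (1 - harmonic n / harmonic N)

lemma harmonic_real_succ (n : ℕ) : (harmonic (n + 1) : ℝ) = harmonic n + 1 / ((n : ℝ) + 1) := by
  rw [harmonic_succ]; push_cast; simp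

lemma harmonic_real_mono {m n : ℕ} (h : m ≤ n) : (harmonic m : ℝ) ≤ harmonic n := by
  refine monotone_nat_of_le_succ (f := fun n => (harmonic n : ℝ)) (fun n => ?_) h
  rw [harmonic_real_succ]
  have : 0 ≤ 1 / ((n : ℝ) + 1) := by positivity
  linarith

lemma one_le_harmonic_real {n : ℕ} (h : 1 ≤ n) : (1 : ℝ) ≤ harmonic n := by
  simpa [harmonic] using harmonic_real_mono h

/-- `1 ≤ N` matters: `harmonic 0 = 0`, and division by zero makes `logCutoff 0` constantly 1. -/
lemma logCutoff_eq_zero {N n : ℕ} (hN : 1 ≤ N) (h : N ≤ n) : logCutoff N n = 0 := by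
  have h1 := one_le_harmonic_real hN
  have h2 := harmonic_real_mono h
  refine max_eq_left (sub_nonpos.2 ?_)
  rwa [one_le_div (by linarith)]

lemma logCutoff_zero (N : ℕ) : logCutoff N 0 = 1 := by simp [logCutoff]

lemma abs_logCutoff_sub_succ_le {N : ℕ} (hN : 1 ≤ N) (n : ℕ) :
    |logCutoff N n - logCutoff N (n + 1)| ≤ 1 / (((n : ℝ) + 1) * harmonic N) := by
  have h1 := one_le_harmonic_real hN
  have h0 : (0 : ℝ) < harmonic N := by linarith
  have h2 : (0 : ℝ) ≤ 1 / (((n : ℝ) + 1) * harmonic N) := by positivity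
  refine (abs_max_sub_max_le_max _ _ _ _).trans (max_le (by simpa using h2) (le_of_eq ?_))
  rw [harmonic_real_succ, ← abs_of_nonneg h2]
  congr 1
  field_simp
  ring

/-- The logarithmic cut-off varies slowly between neighbouring boxes. -/
lemma abs_logCutoff_sub_le {N m n : ℕ} (hN : 1 ≤ N) (h1 : m ≤ n + 1) (h2 : n ≤ m + 1) :
    |logCutoff N n - logCutoff N m| ≤
      if n ≤ N then 1 / (max (n : ℝ) 1 * harmonic N) else 0 := by
  have hH := one_le_harmonic_real hN
  split_ifs with hn
  -- Outward the increment is at most 1/(n + 1), inward at most 1/n, both relative to `harmonic N`;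
  -- `max n 1` serves both.
  · rcases (by omega : m = n + 1 ∨ m = n ∨ n = m + 1) with rfl | rfl | rfl
    · refine (abs_logCutoff_sub_succ_le hN n).trans ?_
      gcongr
      exact max_le (by linarith) (by linarith [(Nat.cast_nonneg n : (0 : ℝ) ≤ n)])
    · simp only [sub_self, abs_zero]
      positivity
    · rw [abs_sub_comm]
      refine (abs_logCutoff_sub_succ_le hN m).trans (le_of_eq ?_)
      rw [max_eq_left] <;> push_cast
      · rfl
      · linarith [(Nat.cast_nonneg m : (0 : ℝ) ≤ m)]
  · rw [logCutoff_eq_zero hN (by omega), logCutoff_eq_zero hN (by omega)]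
    simp

/-- The box `{k : |k|∞ ≤ N}`. -/
noncomputable def fullBox (N : ℕ) : Finset (ℤ × ℤ) := (Finset.range (N + 1)).biUnion Finset.box

lemma mem_fullBox {N : ℕ} {k : ℤ × ℤ} : k ∈ fullBox N ↔ boxNorm k ≤ N := by
  simp only [fullBox, Finset.mem_biUnion, Finset.mem_range, Int.mem_box, boxNorm]
  constructor
  · rintro ⟨n, h1, h2⟩; omega
  · intro h; exact ⟨_, by omega, rfl⟩

/-- The sphere of radius n ≥ 1 has 8n points, so the sum grows only like `harmonic N`, which loses
to the factor 1/(`harmonic N`)² in the energy. -/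
lemma sum_fullBox_inv_sq_le (N : ℕ) :
    ∑ k ∈ fullBox N, 1 / (max (boxNorm k : ℝ) 1) ^ 2 ≤ 1 + 8 * (harmonic N : ℝ) := by
  rw [fullBox, Finset.sum_biUnion]
  · have key : ∀ n ∈ Finset.range (N + 1), ∑ k ∈ (Finset.box n : Finset (ℤ × ℤ)),
        1 / (max (boxNorm k : ℝ) 1) ^ 2 = if n = 0 then (1 : ℝ) else 8 / n := by
      intro n _
      rw [Finset.sum_congr rfl (g := fun _ => 1 / (max (n : ℝ) 1) ^ 2)]
      · split_ifs with hn
        · subst hn; simp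
        · have : (1 : ℝ) ≤ n := by exact_mod_cast Nat.one_le_iff_ne_zero.2 hn
          rw [Finset.sum_const, Int.card_box hn, max_eq_left this, nsmul_eq_mul]
          push_cast
          field_simp
      · intro k hk
        rw [Int.mem_box] at hk
        rw [boxNorm, hk]
    rw [Finset.sum_congr rfl key, Finset.sum_range_succ', harmonic]
    push_cast
    rw [Finset.mul_sum, add_comm]
    simp [div_eq_mul_inv]
  · intro m _ n _ hmn
    refine Finset.disjoint_left.2 fun k hk hk' => hmn ?_
    rw [Int.mem_box] at hk hk'
    omega


/-! ### Small-energy test functions against square-summable Green functions. -/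

/-- In dimension two the adjoint equation has compactly supported approximate solutions of
arbitrarily small energy when the discriminant is nonpositive. -/
lemma exists_small_energy (a b c : ℝ)
    (hD : (1 - a - b - c) * (1 - a + b + c) * (1 + a - b + c) * (1 + a + b - c) ≤ 0)
    (N : ℕ) (hN : 1 ≤ N) :
    ∃ g : ℤ × ℤ → ℝ, g 0 = 1 ∧ (∀ k, k ∉ fullBox N → g k = 0) ∧
      (∀ k, k ∉ fullBox N →
        g k - a * g (k + (1, 0)) - b * g (k + (0, 1)) - c * g (k + (1, 1)) = 0) ∧
      ∑ k ∈ fullBox N,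
        (g k - a * g (k + (1, 0)) - b * g (k + (0, 1)) - c * g (k + (1, 1))) ^ 2 ≤
        9 * (|a| + |b| + |c|) ^ 2 / harmonic N := by
  obtain ⟨u, hu0, hu1, hu⟩ := exists_bounded_homogeneous_solution a b c hD
  have hH := one_le_harmonic_real hN
  have hH0 : (0 : ℝ) < harmonic N := by linarith
  set φ : ℤ × ℤ → ℝ := fun k => logCutoff N (boxNorm k) with hφ
  set δ : ℤ × ℤ → ℝ := fun k =>
    if boxNorm k ≤ N then 1 / (max (boxNorm k : ℝ) 1 * harmonic N) else 0 with hδ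
  have step (k e : ℤ × ℤ) (he : e.1.natAbs ≤ 1 ∧ e.2.natAbs ≤ 1) (t : ℝ) :
      |t * ((φ k - φ (k + e)) * u (k + e))| ≤ |t| * δ k := by
    have h1 : |φ k - φ (k + e)| ≤ δ k := by
      refine abs_logCutoff_sub_le hN ?_ ?_ <;> simp only [boxNorm, Prod.fst_add, Prod.snd_add] <;>
        omega
    rw [abs_mul, abs_mul]
    refine mul_le_mul_of_nonneg_left ?_ (abs_nonneg t)
    calc _ ≤ δ k * 1 := mul_le_mul h1 (hu1 _) (abs_nonneg _) ((abs_nonneg _).trans h1)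
      _ = δ k := mul_one _
  have bound (k : ℤ × ℤ) : |φ k * u k - a * (φ (k + (1, 0)) * u (k + (1, 0))) -
      b * (φ (k + (0, 1)) * u (k + (0, 1))) - c * (φ (k + (1, 1)) * u (k + (1, 1)))| ≤
      (|a| + |b| + |c|) * δ k := by
    have h1 := step k (1, 0) (by simp) a
    have h2 := step k (0, 1) (by simp) b
    have h3 := step k (1, 1) (by simp) c
    -- Subtracting φ(k) times the equation for u leaves only increments of the cut-off.
    have h4 : φ k * u k - a * (φ (k + (1, 0)) * u (k + (1, 0))) -
      b * (φ (k + (0, 1)) * u (k + (0, 1))) - c * (φ (k + (1, 1)) * u (k + (1, 1))) =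
      a * ((φ k - φ (k + (1, 0))) * u (k + (1, 0))) +
      b * ((φ k - φ (k + (0, 1))) * u (k + (0, 1))) +
      c * ((φ k - φ (k + (1, 1))) * u (k + (1, 1))) := by
      linear_combination φ k * hu k
    rw [h4]
    linarith [abs_add_three (a * ((φ k - φ (k + (1, 0))) * u (k + (1, 0))))
      (b * ((φ k - φ (k + (0, 1))) * u (k + (0, 1))))
      (c * ((φ k - φ (k + (1, 1))) * u (k + (1, 1))))]
  refine ⟨fun k => φ k * u k, ?_, fun k hk => ?_, fun k hk => ?_, ?_⟩
  · simp [hφ, boxNorm, logCutoff_zero, hu0]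
  · rw [mem_fullBox, not_le] at hk
    simp [hφ, logCutoff_eq_zero hN hk.le]
  · have h1 := bound k
    rw [mem_fullBox] at hk
    simp only [hδ, if_neg hk, mul_zero] at h1
    exact abs_nonpos_iff.1 h1
  · calc _ ≤ ∑ k ∈ fullBox N, (|a| + |b| + |c|) ^ 2 / (harmonic N : ℝ) ^ 2 *
          (1 / (max (boxNorm k : ℝ) 1) ^ 2) := by
          refine Finset.sum_le_sum fun k hk => ?_
          have h1 := bound k
          rw [mem_fullBox] at hk
          simp only [hδ, if_pos hk] at h1
          refine (sq_le_sq.2 (h1.trans (le_abs_self _))).trans (le_of_eq ?_)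
          have : (0 : ℝ) < max (boxNorm k : ℝ) 1 := by positivity
          field_simp
      _ ≤ (|a| + |b| + |c|) ^ 2 / (harmonic N : ℝ) ^ 2 * (1 + 8 * (harmonic N : ℝ)) := by
          rw [← Finset.mul_sum]
          exact mul_le_mul_of_nonneg_left (sum_fullBox_inv_sq_le N) (by positivity)
      _ ≤ (|a| + |b| + |c|) ^ 2 / (harmonic N : ℝ) ^ 2 * (9 * (harmonic N : ℝ)) := by
          gcongr
          linarith
      _ = _ := by field_simp

lemma tsum_adjoint_shift {g r : ℤ × ℤ → ℝ} (e : ℤ × ℤ) :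
    ∑' k, g (k + e) * r k = ∑' k, g k * r (k - e) := by
  rw [← (Equiv.subRight e).tsum_eq (fun k => g (k + e) * r k)]
  simp

/-- A planar autoregressive equation with nonpositive discriminant has no square-summable Green
function. -/
lemma eq_zero_of_sq_summable_green (a b c : ℝ)
    (hD : (1 - a - b - c) * (1 - a + b + c) * (1 + a - b + c) * (1 + a + b - c) ≤ 0)
    (r : ℤ × ℤ → ℝ) (C v : ℝ) (hr : ∀ s : Finset (ℤ × ℤ), ∑ k ∈ s, r k ^ 2 ≤ C)
    (hv : ∀ k, r k - a * r (k - (1, 0)) - b * r (k - (0, 1)) - c * r (k - (1, 1)) =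
      if k = 0 then v else 0) : v = 0 := by
  have hC : 0 ≤ C := by simpa using hr ∅
  have key (N : ℕ) (hN : 1 ≤ N) : v ^ 2 ≤ 9 * (|a| + |b| + |c|) ^ 2 * C / harmonic N := by
    obtain ⟨g, hg0, hgs, hhs, hE⟩ := exists_small_energy a b c hD N hN
    set h : ℤ × ℤ → ℝ := fun k =>
      g k - a * g (k + (1, 0)) - b * g (k + (0, 1)) - c * g (k + (1, 1)) with hh
    have hsum (q : ℤ × ℤ → ℝ) : Summable fun k => g k * q k :=
      summable_of_ne_finset_zero (s := fullBox N) fun k hk => by simp [hgs k hk]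
    have hsum' (e : ℤ × ℤ) : Summable fun k => g (k + e) * r k := by
      rw [← (Equiv.subRight e).summable_iff]
      simpa [Function.comp_def] using hsum fun k => r (k - e)
    -- Summation by parts: the operator moves from g to r, where it leaves mass v at the origin, and
    -- g(0) = 1.
    have h1 : ∑ k ∈ fullBox N, h k * r k = v := by
      rw [← tsum_eq_sum (L := .unconditional _) fun k hk => by simp only [hh, hhs k hk, zero_mul]]
      calc ∑' k, h k * r k = ∑' k, (g k * r k - a * (g (k + (1, 0)) * r k) -
            b * (g (k + (0, 1)) * r k) - c * (g (k + (1, 1)) * r k)) :=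
            tsum_congr fun k => by simp only [hh]; ring
        _ = ∑' k, (g k * r k - a * (g k * r (k - (1, 0))) -
            b * (g k * r (k - (0, 1))) - c * (g k * r (k - (1, 1)))) := by
            have s0 := hsum r
            have s1 := (hsum' (1, 0)).mul_left a
            have s2 := (hsum' (0, 1)).mul_left b
            have s3 := (hsum' (1, 1)).mul_left c
            have t1 := (hsum fun k => r (k - (1, 0))).mul_left a
            have t2 := (hsum fun k => r (k - (0, 1))).mul_left b
            have t3 := (hsum fun k => r (k - (1, 1))).mul_left c
            rw [((s0.sub s1).sub s2).tsum_sub s3, (s0.sub s1).tsum_sub s2, s0.tsum_sub s1,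
              ((s0.sub t1).sub t2).tsum_sub t3, (s0.sub t1).tsum_sub t2, s0.tsum_sub t1]
            simp only [tsum_mul_left, tsum_adjoint_shift]
        _ = ∑' k, if k = 0 then v else 0 := tsum_congr fun k => by
            have h2 := hv k
            split_ifs at h2 ⊢ with hk
            · rw [hk, hg0] at *
              linear_combination h2
            · linear_combination g k * h2
        _ = v := tsum_ite_eq 0 _
    calc v ^ 2 = (∑ k ∈ fullBox N, h k * r k) ^ 2 := by rw [h1]
      _ ≤ (∑ k ∈ fullBox N, h k ^ 2) * ∑ k ∈ fullBox N, r k ^ 2 :=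
        Finset.sum_mul_sq_le_sq_mul_sq _ _ _
      _ ≤ 9 * (|a| + |b| + |c|) ^ 2 / harmonic N * C :=
        mul_le_mul hE (hr _) (Finset.sum_nonneg fun _ _ => sq_nonneg _)
          ((Finset.sum_nonneg fun _ _ => sq_nonneg _).trans hE)
      _ = _ := by ring
  have hlim : Filter.Tendsto (fun N : ℕ => 9 * (|a| + |b| + |c|) ^ 2 * C / (harmonic N : ℝ))
      Filter.atTop (nhds 0) := by
    refine Filter.Tendsto.const_div_atTop ?_ _
    refine Filter.tendsto_atTop_mono log_add_one_le_harmonic ?_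
    exact Real.tendsto_log_atTop.comp
      (tendsto_natCast_atTop_atTop.comp (Filter.tendsto_add_atTop_nat 1))
  have := ge_of_tendsto hlim (Filter.eventually_atTop.2 ⟨1, fun N hN => key N hN⟩)
  exact pow_eq_zero_iff two_ne_zero |>.1 (le_antisymm this (sq_nonneg v))

/-! ### Covariances and necessity of D > 0. -/

/-- Bessel's inequality for the covariance with an uncorrelated family of common variance. -/
lemma sum_sq_covariance_le {Ω ι : Type*} [MeasurableSpace Ω] {P : Measure Ω}
    [IsProbabilityMeasure P] {Y : Ω → ℝ} {e : ι → Ω → ℝ} {v : ℝ} (hv : 0 < v)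
    (hY : MemLp Y 2 P) (he : ∀ i, MemLp (e i) 2 P) (hvar : ∀ i, cov[e i, e i; P] = v)
    (hcov : ∀ i j, i ≠ j → cov[e i, e j; P] = 0) (s : Finset ι) :
    ∑ i ∈ s, cov[Y, e i; P] ^ 2 ≤ v * variance Y P := by
  classical
  set q : ι → ℝ := fun i => cov[Y, e i; P] with hq
  -- Z is the covariance projection of Y onto the span of the e i; the inequality is Var(Y - Z) ≥ 0.
  set Z : Ω → ℝ := ∑ i ∈ s, (q i / v) • e i with hZ
  have heq (i : ι) : MemLp ((q i / v) • e i) 2 P := (he i).const_smul _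
  have hZm : MemLp Z 2 P := memLp_finsetSum' s fun i _ => heq i
  have h1 : cov[Y, Z; P] = (∑ i ∈ s, q i ^ 2) / v := by
    rw [hZ, covariance_sum_right' (fun i _ => heq i) hY, Finset.sum_div]
    refine Finset.sum_congr rfl fun i _ => ?_
    rw [covariance_smul_right]
    simp only [hq]
    ring
  have h2 : cov[Z, Z; P] = (∑ i ∈ s, q i ^ 2) / v := by
    rw [hZ, covariance_sum_sum' (fun i _ => heq i) (fun i _ => heq i), Finset.sum_div]
    refine Finset.sum_congr rfl fun i hi => ?_
    rw [Finset.sum_eq_single i]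
    · rw [covariance_smul_left, covariance_smul_right, hvar]
      field_simp
    · intro j _ hj
      rw [covariance_smul_left, covariance_smul_right, hcov i j hj.symm]
      simp
    · exact fun h => absurd hi h
  have h3 : 0 ≤ cov[Y - Z, Y - Z; P] := by
    rw [covariance_self (hY.sub hZm).aemeasurable]
    exact variance_nonneg _ _
  rw [covariance_sub_sub hY hZm hY hZm, covariance_comm Z Y, h1, h2,
    covariance_self hY.aemeasurable] at h3
  have h4 : (∑ i ∈ s, q i ^ 2) / v ≤ variance Y P := by linarith
  rwa [div_le_iff₀' hv] at h4

lemma covariance_congr_left {Ω : Type*} [MeasurableSpace Ω] {P : Measure Ω} {X X' Y : Ω → ℝ}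
    (h : X =ᵐ[P] X') : cov[X, Y; P] = cov[X', Y; P] := by
  rw [covariance, covariance, integral_congr_ae h]
  refine integral_congr_ae ?_
  filter_upwards [h] with ω hω
  rw [hω]

section
variable {Ω : Type*} [MeasurableSpace Ω] {P : Measure Ω} [IsProbabilityMeasure P] {a b c : ℝ}
  {X ε : ℤ → ℤ → Ω → ℝ}

lemma SatisfiesPlanarAR.covariance_eq (h : SatisfiesPlanarAR P a b c X ε)
    (hX : IsWideSenseStationary P X) (hε : ∀ i j, MemLp (ε i j) 2 P) {Y : Ω → ℝ}
    (hY : MemLp Y 2 P) (i j : ℤ) :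
    cov[ε i j, Y; P] = cov[X i j, Y; P] - a * cov[X (i - 1) j, Y; P] -
      b * cov[X i (j - 1), Y; P] - c * cov[X (i - 1) (j - 1), Y; P] := by
  have hm := hX.memLp_two
  have h1 : cov[X i j, Y; P] = cov[a • X (i - 1) j + b • X i (j - 1) + c • X (i - 1) (j - 1) +
      ε i j, Y; P] := by
    refine covariance_congr_left ?_
    filter_upwards [h i j] with ω hω
    simpa using hω
  have m1 := (hm (i - 1) j).const_smul a
  have m2 := (hm i (j - 1)).const_smul b
  have m3 := (hm (i - 1) (j - 1)).const_smul c
  rw [covariance_add_left ((m1.add m2).add m3) (hε i j) hY, covariance_add_left (m1.add m2) m3 hY,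
    covariance_add_left m1 m2 hY, covariance_smul_left, covariance_smul_left,
    covariance_smul_left] at h1
  linarith

/-- The cross-covariance of the solution and the noise depends only on the lag. -/
lemma SatisfiesPlanarAR.covariance_noise_shift (h : SatisfiesPlanarAR P a b c X ε)
    (hX : IsWideSenseStationary P X) (hε : ∀ i j, MemLp (ε i j) 2 P) (i j k l : ℤ) :
    cov[X i j, ε k l; P] = cov[X (i - k) (j - l), ε 0 0; P] := by
  obtain ⟨γ, hγ⟩ := hX.covariance_shift
  have hγ' (i j k l : ℤ) : cov[X k l, X i j; P] = γ (i - k) (j - l) := by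
    rw [covariance_comm, ← hγ i j (i - k) (j - l), sub_sub_cancel, sub_sub_cancel]
  have hm := hX.memLp_two
  -- Expanding the noise by the equation leaves only autocovariances of X.
  rw [covariance_comm, covariance_comm (X (i - k) _), h.covariance_eq hX hε (hm _ _),
    h.covariance_eq hX hε (hm _ _)]
  simp only [hγ']
  ring_nf

theorem SatisfiesPlanarAR.discriminant_pos {v : ℝ} (hv : 0 < v)
    (h : SatisfiesPlanarAR P a b c X ε) (hX : IsWideSenseStationary P X)
    (hε : IsWhiteNoise P ε v) :
    0 < (1 - a - b - c) * (1 - a + b + c) * (1 + a - b + c) * (1 + a + b - c) := by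
  by_contra hD
  have hm := hε.memLp_two
  have hvar (i j : ℤ) : cov[ε i j, ε i j; P] = v := by
    rw [covariance_self (hm i j).aemeasurable, hε.variance_eq]
  refine hv.ne' (eq_zero_of_sq_summable_green a b c (not_lt.1 hD)
    (fun k => cov[X k.1 k.2, ε 0 0; P]) (v * variance (X 0 0) P) v (fun s => ?_) fun k => ?_)
  -- Since Cov(X_k, ε_0) = Cov(X_0, ε_{-k}), Bessel for the single variable X_0 controls all of r.
  · have hs := sum_sq_covariance_le hv (hX.memLp_two 0 0)
      (e := fun k : ℤ × ℤ => ε (-k.1) (-k.2)) (fun k => hm _ _) (fun k => hvar _ _)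
      (fun k l hkl => hε.uncorrelated _ _ _ _ fun h0 => hkl ?_) s
    · refine (Finset.sum_congr rfl fun k _ => ?_).trans_le hs
      rw [h.covariance_noise_shift hX hm 0 0 (-k.1) (-k.2)]
      simp
    · simpa [Prod.ext_iff] using h0
  · have h1 := h.covariance_eq hX hm (hm 0 0) k.1 k.2
    simp only [Prod.fst_sub, Prod.snd_sub, sub_zero]
    rw [← h1]
    split_ifs with hk
    · rw [hk]; exact hvar 0 0
    · exact hε.uncorrelated _ _ _ _ hk
end

/-! ### Lower bounds and solvability in Hilbert space. -/

open scoped RealInnerProductSpace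

section
variable {E : Type*} [NormedAddCommGroup E] [InnerProductSpace ℝ E]

lemma norm_sq_sub_norm_sq_of_isometry (a b c : ℝ) (U : E →ₗᵢ[ℝ] E) (x : E) :
    ‖x - a • U x‖ ^ 2 - ‖b • x + c • U x‖ ^ 2 =
      (1 + a ^ 2 - b ^ 2 - c ^ 2) * ‖x‖ ^ 2 - 2 * (a + b * c) * ⟪x, U x⟫ := by
  rw [norm_sub_sq_real, norm_add_sq_real, norm_smul, norm_smul, norm_smul, inner_smul_right,
    inner_smul_left, inner_smul_right, U.norm_map]
  simp only [mul_pow, Real.norm_eq_abs, sq_abs, conj_trivial]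
  ring

/-- The planar autoregressive operator built from two isometries is bounded below when the
discriminant is positive. -/
lemma exists_pos_mul_norm_le_planarAR (a b c : ℝ)
    (hD : 0 < (1 - a - b - c) * (1 - a + b + c) * (1 + a - b + c) * (1 + a + b - c))
    (U V : E →ₗᵢ[ℝ] E) :
    ∃ C : ℝ, 0 < C ∧ ∀ x : E, C * ‖x‖ ≤ ‖x - a • U x - b • V x - c • V (U x)‖ := by
  rw [planarAR_discriminant, sub_pos, sq_lt_sq] at hD
  set K := 1 + a ^ 2 - b ^ 2 - c ^ 2 with hK
  set L := 2 * (a + b * c) with hL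
  set M := 1 + |a| + |b| + |c| with hM
  have hM0 : 0 < M := by positivity
  refine ⟨(|K| - |L|) / M, div_pos (sub_pos.2 hD) hM0, fun x => ?_⟩
  rcases (norm_nonneg x).eq_or_lt with hx | hx
  · rw [← hx, mul_zero]; exact norm_nonneg _
  set A := x - a • U x with hA
  set B := b • x + c • U x with hB
  have hT : x - a • U x - b • V x - c • V (U x) = A - V B := by
    rw [hA, hB, map_add, map_smul, map_smul]; abel
  -- V enters only through ‖V B‖ = ‖B‖, so the one-variable identity in U suffices and U, V need not
  -- commute.
  have h1 : |‖A‖ - ‖B‖| ≤ ‖A - V B‖ := by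
    have := abs_norm_sub_norm_le A (V B)
    rwa [V.norm_map] at this
  have h2 : ‖A‖ + ‖B‖ ≤ M * ‖x‖ := by
    have e1 := norm_sub_le x (a • U x)
    have e2 := norm_add_le (b • x) (c • U x)
    rw [norm_smul, U.norm_map, Real.norm_eq_abs] at e1
    rw [norm_smul, norm_smul, U.norm_map, Real.norm_eq_abs, Real.norm_eq_abs] at e2
    rw [hM]
    linarith
  have h3 : (|K| - |L|) * ‖x‖ ^ 2 ≤ |‖A‖ ^ 2 - ‖B‖ ^ 2| := by
    rw [norm_sq_sub_norm_sq_of_isometry]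
    have e1 := abs_sub_abs_le_abs_sub (K * ‖x‖ ^ 2) (L * ⟪x, U x⟫)
    have e2 : |L * ⟪x, U x⟫| ≤ |L| * ‖x‖ ^ 2 := by
      rw [abs_mul, sq]
      refine mul_le_mul_of_nonneg_left ?_ (abs_nonneg L)
      simpa using abs_real_inner_le_norm x (U x)
    rw [abs_mul, abs_of_nonneg (sq_nonneg ‖x‖)] at e1
    linarith
  have h4 : |‖A‖ ^ 2 - ‖B‖ ^ 2| ≤ ‖A - V B‖ * (M * ‖x‖) := by
    rw [sq_sub_sq, abs_mul, mul_comm, abs_of_nonneg (add_nonneg (norm_nonneg A) (norm_nonneg B))]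
    exact mul_le_mul h1 h2 (by positivity) (norm_nonneg _)
  rw [hT, div_mul_eq_mul_div, div_le_iff₀ hM0]
  refine le_of_mul_le_mul_right ?_ hx
  linarith

/-- If the adjoint of an operator is bounded below, the operator is onto; stated weakly. -/
lemma exists_inner_apply_eq [CompleteSpace E] (Q : E →L[ℝ] E) {C : ℝ} (hC : 0 < C)
    (hQ : ∀ x, C * ‖x‖ ≤ ‖Q x‖) (f : E) : ∃ r : E, ∀ x, ⟪r, Q x⟫ = ⟪f, x⟫ := by
  -- Lax–Milgram for the form ⟪Q x, Q y⟫, whose solution y gives r = Q y.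
  have hB : IsCoercive ((innerSL ℝ).bilinearComp Q Q : E →L[ℝ] E →L[ℝ] ℝ) := by
    refine ⟨C ^ 2, by positivity, fun x => ?_⟩
    change C ^ 2 * ‖x‖ * ‖x‖ ≤ ⟪Q x, Q x⟫
    rw [real_inner_self_eq_norm_mul_norm]
    calc C ^ 2 * ‖x‖ * ‖x‖ = (C * ‖x‖) * (C * ‖x‖) := by ring
      _ ≤ _ := mul_self_le_mul_self (by positivity) (hQ x)
  refine ⟨Q (hB.continuousLinearEquivOfBilin.symm f), fun x => ?_⟩
  have := hB.continuousLinearEquivOfBilin_apply (hB.continuousLinearEquivOfBilin.symm f) x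
  rw [ContinuousLinearEquiv.apply_symm_apply] at this
  exact this.symm

end

/-! ### Translations and the kernel in ℓ²(ℤ²). -/

/-- The Hilbert space of square-summable real families on `ℤ²`. -/
abbrev PlanarL2 := lp (fun _ : ℤ × ℤ => ℝ) 2

lemma memℓp_comp_equiv {ι κ : Type*} (σ : ι ≃ κ) {f : κ → ℝ} (hf : Memℓp f 2) :
    Memℓp (fun k => f (σ k)) 2 := by
  rw [memℓp_gen_iff (by simp)] at hf ⊢
  exact (σ.summable_iff (f := fun k => ‖f k‖ ^ (2 : ENNReal).toReal)).2 hf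

/-- Translation by `s` on `ℓ²(ℤ²)`. -/
noncomputable def planarShift (s : ℤ × ℤ) : PlanarL2 →ₗᵢ[ℝ] PlanarL2 where
  toFun f := ⟨fun k => f (k - s), memℓp_comp_equiv (Equiv.subRight s) (lp.memℓp f)⟩
  map_add' f g := by ext k; rfl
  map_smul' t f := by ext k; rfl
  norm_map' f := by
    have h2 : 0 < (2 : ENNReal).toReal := by simp
    rw [lp.norm_eq_tsum_rpow h2, lp.norm_eq_tsum_rpow h2,
      ← (Equiv.subRight s).tsum_eq (fun k => ‖f k‖ ^ (2 : ENNReal).toReal)]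
    rfl

lemma planarShift_apply (s : ℤ × ℤ) (f : PlanarL2) (k : ℤ × ℤ) :
    planarShift s f k = f (k - s) := rfl

lemma inner_planarShift (s t : ℤ × ℤ) (f : PlanarL2) :
    ⟪planarShift s f, planarShift t f⟫ = ⟪f, planarShift (t - s) f⟫ := by
  rw [lp.inner_eq_tsum, lp.inner_eq_tsum,
    ← (Equiv.subRight s).tsum_eq (fun k => ⟪f k, planarShift (t - s) f k⟫)]
  refine tsum_congr fun k => ?_
  simp only [planarShift_apply, Equiv.subRight_apply]
  rw [sub_sub, add_sub_cancel]

lemma planarShift_single (s k : ℤ × ℤ) (t : ℝ) :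
    planarShift s (lp.single 2 k t) = lp.single 2 (k + s) t := by
  ext l
  rw [planarShift_apply, lp.single_apply, lp.single_apply]
  simp only [Pi.single_apply, sub_eq_iff_eq_add]

/-- With positive discriminant, the planar autoregressive equation has a square-summable kernel. -/
lemma exists_sq_summable_kernel (a b c : ℝ)
    (hD : 0 < (1 - a - b - c) * (1 - a + b + c) * (1 + a - b + c) * (1 + a + b - c)) :
    ∃ r : PlanarL2, r - a • planarShift (-1, 0) r - b • planarShift (0, -1) r -
      c • planarShift (-1, -1) r = lp.single 2 0 1 := by
  obtain ⟨C, hC, h⟩ := exists_pos_mul_norm_le_planarAR a b c hD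
    (planarShift (1, 0)) (planarShift (0, 1))
  set U := (planarShift (1, 0)).toContinuousLinearMap
  set V := (planarShift (0, 1)).toContinuousLinearMap
  obtain ⟨r, hr⟩ := exists_inner_apply_eq
    (ContinuousLinearMap.id ℝ PlanarL2 - a • U - b • V - c • V.comp U) hC h (lp.single 2 0 1)
  refine ⟨r, ?_⟩
  ext k
  -- Testing against unit vectors reads off coordinates; passing to the adjoint turns the shifts
  -- into their inverses.
  have h1 := hr (lp.single 2 k 1)
  have h2 : (ContinuousLinearMap.id ℝ PlanarL2 - a • U - b • V - c • V.comp U)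
      (lp.single 2 k 1) = lp.single 2 k (1 : ℝ) - a • lp.single 2 (k + (1, 0)) (1 : ℝ) -
        b • lp.single 2 (k + (0, 1)) (1 : ℝ) - c • lp.single 2 (k + (1, 0) + (0, 1)) (1 : ℝ) := by
    rw [← planarShift_single (1, 0), ← planarShift_single (0, 1) (k + (1, 0)),
      ← planarShift_single (0, 1), ← planarShift_single (1, 0)]
    rfl
  rw [h2, inner_sub_right, inner_sub_right, inner_sub_right, inner_smul_right, inner_smul_right,
    inner_smul_right, lp.inner_single_right, lp.inner_single_right, lp.inner_single_right,
    lp.inner_single_right, lp.inner_single_right] at h1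
  simp only [lp.coeFn_sub, lp.coeFn_smul, Pi.sub_apply, Pi.smul_apply, planarShift_apply,
    smul_eq_mul]
  have e1 : k - (-1, 0) = k + (1, 0) := by ext <;> simp
  have e2 : k - (0, -1) = k + (0, 1) := by ext <;> simp
  have e3 : k - (-1, -1) = k + (1, 0) + (0, 1) := by ext <;> simp
  rw [e1, e2, e3]
  simpa using h1


lemma planarShift_planarShift (s t : ℤ × ℤ) (f : PlanarL2) :
    planarShift s (planarShift t f) = planarShift (s + t) f := by
  ext k
  simp only [planarShift_apply, sub_sub]

/-! ### White noise and construction of the field. -/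

/-- In any universe there are uncorrelated standardised variables indexed by `ℤ²`. -/
lemma exists_isWhiteNoise_one : ∃ (Ω : Type u) (_ : MeasurableSpace Ω) (P : Measure Ω)
    (_ : IsProbabilityMeasure P) (ε : ℤ → ℤ → Ω → ℝ), IsWhiteNoise P ε 1 := by
  obtain ⟨Ω, mΩ, P, Z, hZm, hZ, hind, hP⟩ :=
    exists_iid.{0, u} (ULift.{u} (ℤ × ℤ)) (gaussianReal 0 1)
  have hL (i) : MemLp (Z i) 2 P := by
    have h1 : MemLp id 2 (P.map (Z i)) := by
      rw [(hZ i).map_eq]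
      exact memLp_id_gaussianReal 2
    exact (memLp_map_measure_iff aestronglyMeasurable_id (hZm i).aemeasurable).1 h1
  refine ⟨Ω, mΩ, P, hP, fun i j => Z ⟨(i, j)⟩, fun i j => hZm _, fun i j => hL _,
    fun i j => ?_, fun i j => ?_, fun i j k l h => ?_⟩
  · rw [(hZ _).integral_eq, integral_id_gaussianReal]
  · rw [(hZ _).variance_eq, variance_id_gaussianReal]
    rfl
  · refine (hind.indepFun ?_).covariance_eq_zero (hL _) (hL _)
    simpa using h

section
variable {Ω : Type*} [MeasurableSpace Ω] {P : Measure Ω} [IsProbabilityMeasure P]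

/-- As an inner product the mean is continuous on L², so zero means survive infinite sums. -/
lemma integral_Lp_two_eq_inner (f : Lp ℝ 2 P) :
    ∫ ω, f ω ∂P = ⟪indicatorConstLp 2 MeasurableSet.univ (measure_ne_top P _) (1 : ℝ), f⟫ := by
  rw [L2.inner_indicatorConstLp_one, Measure.restrict_univ]

lemma covariance_Lp_two_eq_inner {f g : Lp ℝ 2 P} (hf : ∫ ω, f ω ∂P = 0) :
    cov[f, g; P] = ⟪f, g⟫ := by
  rw [covariance_eq_sub (Lp.memLp f) (Lp.memLp g), hf, zero_mul, sub_zero, L2.inner_def]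
  refine integral_congr_ae (Filter.Eventually.of_forall fun ω => ?_)
  simp [mul_comm]

/-- A white noise of unit variance induces an isometric embedding of `ℓ²(ℤ²)` into the centred
square-integrable variables. -/
lemma IsWhiteNoise.exists_isometry {ε : ℤ → ℤ → Ω → ℝ} (h : IsWhiteNoise P ε 1) :
    ∃ W : PlanarL2 →ₗᵢ[ℝ] Lp ℝ 2 P, (∀ f, ∫ ω, W f ω ∂P = 0) ∧
      ∀ s, W (lp.single 2 s 1) =ᵐ[P] ε s.1 s.2 := by
  set e : ℤ × ℤ → Lp ℝ 2 P := fun s => (h.memLp_two s.1 s.2).toLp with he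
  have hae (s) : e s =ᵐ[P] ε s.1 s.2 := (h.memLp_two s.1 s.2).coeFn_toLp
  have hmean (s) : ∫ ω, e s ω ∂P = 0 := by
    rw [integral_congr_ae (hae s), h.mean_eq_zero]
  have hcov (s t) : ⟪e s, e t⟫ = cov[ε s.1 s.2, ε t.1 t.2; P] := by
    rw [← covariance_Lp_two_eq_inner (hmean s), covariance_congr_left (hae s), covariance_comm,
      covariance_congr_left (hae t), covariance_comm]
  have hO : Orthonormal ℝ e := by
    classical
    rw [orthonormal_iff_ite]
    intro s t
    rw [hcov]
    split_ifs with hst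
    · rw [hst, covariance_self (h.measurable _ _).aemeasurable, h.variance_eq]
    · exact h.uncorrelated _ _ _ _ hst
  refine ⟨hO.orthogonalFamily.linearIsometry, fun f => ?_, fun s => ?_⟩
  · rw [integral_Lp_two_eq_inner]
    have h1 := (hO.orthogonalFamily.hasSum_linearIsometry f).mapL
      (innerSL ℝ (indicatorConstLp 2 MeasurableSet.univ (measure_ne_top P _) (1 : ℝ)))
    refine h1.unique ?_
    convert hasSum_zero using 2 with s
    rw [innerSL_apply_apply, LinearIsometry.toSpanSingleton_apply, inner_smul_right,
      ← integral_Lp_two_eq_inner, hmean, mul_zero]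
  · rw [OrthogonalFamily.linearIsometry_apply_single, LinearIsometry.toSpanSingleton_apply,
      one_smul]
    exact hae s

end

/-- X_{i,j} is the image under the noise isometry of σ times the kernel translated by (i, j).
Stationarity is translation invariance of the ℓ² inner product, and the equation is the translated
kernel equation. -/
lemma exists_planarAR_of_discriminant_pos (a b c σ : ℝ)
    (hD : 0 < (1 - a - b - c) * (1 - a + b + c) * (1 + a - b + c) * (1 + a + b - c)) :
    ∃ (Ω : Type u) (_ : MeasurableSpace Ω) (P : Measure Ω) (_ : IsProbabilityMeasure P)
      (ε X : ℤ → ℤ → Ω → ℝ),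
      IsWhiteNoise P ε (σ ^ 2) ∧ IsWideSenseStationary P X ∧ SatisfiesPlanarAR P a b c X ε := by
  obtain ⟨Ω, mΩ, P, hP, η, hη⟩ := exists_isWhiteNoise_one.{u}
  obtain ⟨W, hW0, hWs⟩ := hη.exists_isometry
  obtain ⟨r, hr⟩ := exists_sq_summable_kernel a b c hD
  have hmeas (f : PlanarL2) : Measurable (W f) := (Lp.stronglyMeasurable _).measurable
  refine ⟨Ω, mΩ, P, hP, fun i j => σ • η i j, fun i j => W (σ • planarShift (i, j) r),
    ⟨fun i j => (hη.measurable i j).const_smul σ, fun i j => (hη.memLp_two i j).const_smul σ,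
      fun i j => ?_, fun i j => ?_, fun i j k l hne => ?_⟩,
    ⟨fun i j => hmeas _, fun i j => Lp.memLp _, ⟨0, fun i j => hW0 _⟩,
      ⟨fun h₁ h₂ => σ ^ 2 * ⟪r, planarShift (-h₁, -h₂) r⟫, fun i j h₁ h₂ => ?_⟩⟩, fun i j => ?_⟩
  · simp only [Pi.smul_apply]
    rw [integral_smul, hη.mean_eq_zero, smul_zero]
  · rw [variance_smul, hη.variance_eq, mul_one]
  · rw [covariance_smul_left, covariance_smul_right, hη.uncorrelated i j k l hne, mul_zero,
      mul_zero]
  · rw [covariance_Lp_two_eq_inner (hW0 _), W.inner_map_map, inner_smul_left, inner_smul_right,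
      inner_planarShift]
    have : (i - h₁, j - h₂) - (i, j) = (-h₁, -h₂) := by ext <;> simp
    rw [this, conj_trivial]
    ring
  · have h1 : planarShift (i, j) r = a • planarShift (i - 1, j) r + b • planarShift (i, j - 1) r +
        c • planarShift (i - 1, j - 1) r + lp.single 2 (i, j) 1 := by
      have h2 := congrArg (planarShift (i, j)) hr
      rw [planarShift_single, map_sub, map_sub, map_sub, map_smul, map_smul, map_smul,
        planarShift_planarShift, planarShift_planarShift, planarShift_planarShift] at h2
      simp only [Prod.mk_add_mk, add_zero, zero_add, ← sub_eq_add_neg] at h2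
      rw [← h2]
      abel
    have h3 : W (σ • planarShift (i, j) r) = a • W (σ • planarShift (i - 1, j) r) +
        b • W (σ • planarShift (i, j - 1) r) + c • W (σ • planarShift (i - 1, j - 1) r) +
        σ • W (lp.single 2 (i, j) 1) := by
      rw [h1]
      simp only [map_add, map_smul, smul_add, smul_comm σ]
    beta_reduce
    rw [h3]
    filter_upwards [Lp.coeFn_add (a • W (σ • planarShift (i - 1, j) r) +
        b • W (σ • planarShift (i, j - 1) r) + c • W (σ • planarShift (i - 1, j - 1) r))
        (σ • W (lp.single 2 (i, j) 1)),
      Lp.coeFn_add (a • W (σ • planarShift (i - 1, j) r) + b • W (σ • planarShift (i, j - 1) r))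
        (c • W (σ • planarShift (i - 1, j - 1) r)),
      Lp.coeFn_add (a • W (σ • planarShift (i - 1, j) r)) (b • W (σ • planarShift (i, j - 1) r)),
      Lp.coeFn_smul a (W (σ • planarShift (i - 1, j) r)),
      Lp.coeFn_smul b (W (σ • planarShift (i, j - 1) r)),
      Lp.coeFn_smul c (W (σ • planarShift (i - 1, j - 1) r)),
      Lp.coeFn_smul σ (W (lp.single 2 (i, j) 1)), hWs (i, j)] with ω e1 e2 e3 e4 e5 e6 e7 e8
    rw [e1, Pi.add_apply, e2, Pi.add_apply, e3, Pi.add_apply, e4, e5, e6, e7]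
    simp only [Pi.smul_apply, smul_eq_mul, e8]

theorem mainTheorem1 (a b c σ : ℝ) (hσ : 0 < σ ^ 2) :
    (∃ (Ω : Type u) (_ : MeasurableSpace Ω) (P : Measure Ω) (_ : IsProbabilityMeasure P)
        (ε X : ℤ → ℤ → Ω → ℝ),
        IsWhiteNoise P ε (σ ^ 2) ∧ IsWideSenseStationary P X ∧ SatisfiesPlanarAR P a b c X ε) ↔
      0 < (1 - a - b - c) * (1 - a + b + c) * (1 + a - b + c) * (1 + a + b - c) := by
  constructor
  · rintro ⟨Ω, _, P, _, ε, X, hε, hX, h⟩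
    exact h.discriminant_pos hσ hX hε
  · exact exists_planarAR_of_discriminant_pos a b c σ
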